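/- **Theorem (nonparametric disentanglement via discrete $a$ with sparse influence).** *Models.* Let $T\ge 1$, let $d_x,d_z,d_a$ be nonnegative integers, let $\mathcal A\subseteq\mathbb R^{d_a}$ be a nonempty set (the possible values of the auxiliary variable, for instance a discrete set; no further property of $\mathcal A$ is used), and let $\sigma^2\ge 0$ be fixed. A model $\theta=(f,p,G)$ consists of a decoder $f:\mathbb R^{d_z}\to\mathbb R^{d_x}$, transition densities $p(z^t\mid z^{<t},a^{<t})$ on $\mathbb R^{d_z}$ for $t=1,\dots,T$, where $z^{<t}=(z^1,\dots,z^{t-1})$ and $a^{<t}=(a^0,\dots,a^{t-1})\in\mathcal A^t$, and binary matrices $G^z\in\{0,1\}^{d_z\times d_z}$, $G^a\in\{0,1\}^{d_z\times d_a}$. The mechanism $p(z_i^t\mid z^{<t},a^{<t})$ is the $i$-th marginal density of $p(z^t\mid z^{<t},a^{<t})$. Given $a^{<T}\in\mathcal A^T$, the latents $z^{\le T}$ have density $\prod_{t=1}^T p(z^t\mid z^{<t},a^{<t})$, and the observations are $x^t=f(z^t)+n^t$ with $n^t\sim\mathcal N(0,\sigma^2 I)$ independent over time and independent of the latents ($n^t=0$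 if $\sigma^2=0$). Let $\theta=(f,p,G)$ and $\hat\theta=(\hat f,\hat p,\hat G)$ be two models, each satisfying: * (observation model) $d_z\le d_x$; $f$ is a $C^1$ diffeomorphism onto its image, meaning that $f$ is $C^1$ and injective and $f^{-1}:f(\mathbb R^{d_z})\to\mathbb R^{d_z}$ extends to a $C^1$ map on an open set containing $f(\mathbb R^{d_z})$; and $f(\mathbb R^{d_z})$ is closed in $\mathbb R^{d_x}$; * (conditional independence) $p(z^t\mid z^{<t},a^{<t})=\prod_{i=1}^{d_z}p(z^t_i\mid z^{<t},a^{<t})$, and the distribution with density $p(z_i^t\mid z^{<t},a^{<t})$ has support $\mathbb R$ (every nonempty open set has positive probability), for all $t$, $i$, $z^{<t}$ and $a^{<t}\in\mathcal A^t$; * (Markov property) for each $i$, $p(z_i^t\mid z^{<t},a^{<t})$ depends on $z^{<t}$ only through the coordinates $j$ with $G^z_{i,j}=1$ and on $a^{<t}\in\mathcal A^t$ only through the coordinates $\ell$ with $G^a_{i,\ell}=1$; * (smoothness) for every $a^{<t}\in\mathcal A^t$, $p(z^t_i\mid z^{<t},a^{<t})$ is $C^2$ as a function of $(z^t_i,z^{<t})\in\mathbb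 R\times\mathbb R^{d_z\times(t-1)}$. Assume moreover: 1. (observational equivalence) for every $a^{<T}\in\mathcal A^T$ the conditional distributions of $x^{\le T}$ given $a^{<T}$ under $\theta$ and $\hat\theta$ coincide; 2. (sufficient influence of $a$) writing $D^t_z$ for the gradient in $z^t$ and $E^{(\ell,\tau)}$ for the matrix whose only nonzero entry is a $1$ at $(\ell,\tau)$, let $$\Delta^{\tau,\epsilon}_{a,\ell}D^t_z\log p(z\mid z^{<t},a^{<t}):=D^t_z\log p(z\mid z^{<t},a^{<t}+\epsilon E^{(\ell,\tau)})-D^t_z\log p(z\mid z^{<t},a^{<t}).$$ Let $\mathrm{Ch}_\ell=\{i: G^a_{i,\ell}=1\}$ and $\mathbb R^{d_z}_{\mathrm{Ch}_\ell}=\{x\in\mathbb R^{d_z}: x_i=0 \text{ for } i\notin \mathrm{Ch}_\ell\}$. For Lebesgue-almost every $z\in\mathbb R^{d_z}$ and every $\ell\in\{1,\dots,d_a\}$ there are $(t_{(r)},\tau_{(r)},z_{(r)},a_{(r)},\epsilon_{(r)})$, $r=1,\dots,|\mathrm{Ch}_\ell|$, with $1\le t_{(r)}\le T$, $0\le\tau_{(r)}<t_{(r)}$,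 $z_{(r)}\in\mathbb R^{d_z\times(t_{(r)}-1)}$, $a_{(r)}\in\mathcal A^{t_{(r)}}$, $\epsilon_{(r)}\in\mathbb R$, $(a_{(r)})_{\cdot,\tau_{(r)}}+\epsilon_{(r)}e_\ell\in\mathcal A$, such that the two densities whose logarithms are taken are positive at $z$ (automatic if the densities vanish nowhere) and $$\mathrm{span}\Big\{\Delta^{\tau_{(r)},\epsilon_{(r)}}_{a,\ell}D^{t_{(r)}}_z\log p(z\mid z_{(r)},a_{(r)})\Big\}_{r=1}^{|\mathrm{Ch}_\ell|}=\mathbb R^{d_z}_{\mathrm{Ch}_\ell}.$$ **Conclusion.** There is a permutation matrix $P$ with $PG^a\subseteq\hat G^a$ (inclusion of the sets of nonzero entries). If in addition $\|\hat G^a\|_0\le\|G^a\|_0$ (numbers of nonzero entries), then $\theta$ and $\hat\theta$ are $a$-consistent, i.e. there is a permutation matrix $P$ such that * $f(\mathbb R^{d_z})=\hat f(\mathbb R^{d_z})$, the entanglement map $v:=f^{-1}\circ\hat f$ is a $C^1$ diffeomorphism of $\mathbb R^{d_z}$, and for all $t$, all $a^{<t}\in\mathcal A^t$ and all $z^{\le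 t}$, $$\hat p(z^t\mid z^{<t},a^{<t})=p(v(z^t)\mid v(z^{<t}),a^{<t})\,|\det Dv(z^t)|$$ (with $v$ applied to each time step of $z^{<t}$), and $\hat G^a=PG^a$; * $v=c\circ P^\top$, where $c$ is a $G^a$-preserving $C^1$ diffeomorphism of $\mathbb R^{d_z}$: its dependency graph $C\in\{0,1\}^{d_z\times d_z}$, defined by $C_{i,j}=0$ iff $c_i$ does not depend on its $j$-th argument, satisfies $C^\top M\in\mathbb R^{d_z\times d_a}_{G^a}$ for all $M\in\mathbb R^{d_z\times d_a}_{G^a}$, where $\mathbb R^{d_z\times d_a}_{G^a}=\{M: G^a_{i,\ell}=0\Rightarrow M_{i,\ell}=0\}$. -/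

import Mathlib

open MeasureTheory ProbabilityTheory
open scoped NNReal ENNReal

noncomputable section

namespace MechSparsity

/-- Real vectors with `d` coordinates. Everything below (derivatives, determinants, closedness,
Lebesgue measure) is independent of the choice of norm. -/
abbrev Vec (d : ℕ) : Type := Fin d → ℝ

/-! ### Matrices, supports, permutation matrices -/

/-- All entries are `0` or `1`. -/
def IsBinary {m n : ℕ} (M : Matrix (Fin m) (Fin n) ℝ) : Prop :=
  ∀ i j, M i j = 0 ∨ M i j = 1

/-- `M ⊆ N`: inclusion of the sets of nonzero positions. -/
def SuppSubset {m n : ℕ} (M N : Matrix (Fin m) (Fin n) ℝ) : Prop :=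
  ∀ i j, M i j ≠ 0 → N i j ≠ 0

/-- `‖M‖₀`: the number of nonzero entries. -/
def l0 {m n : ℕ} (M : Matrix (Fin m) (Fin n) ℝ) : ℕ :=
  Set.ncard {q : Fin m × Fin n | M q.1 q.2 ≠ 0}

/-- `P` is a permutation matrix. -/
def IsPermMatrix {m : ℕ} (P : Matrix (Fin m) (Fin m) ℝ) : Prop :=
  ∃ s : Equiv.Perm (Fin m), P = s.permMatrix ℝ

/-- The aligned subspace of vectors supported in the support of `b`. -/
def alignedVec {m : ℕ} (b : Vec m) : Submodule ℝ (Vec m) where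
  carrier := {x | ∀ i, b i = 0 → x i = 0}
  add_mem' := by
    intro x y hx hy i hi
    simp [hx i hi, hy i hi]
  zero_mem' := by
    intro i _
    rfl
  smul_mem' := by
    intro c x hx i hi
    simp [hx i hi]

/-- The aligned space of matrices supported in the support of `B`. -/
def alignedMat {m n : ℕ} (B : Matrix (Fin m) (Fin n) ℝ) : Set (Matrix (Fin m) (Fin n) ℝ) :=
  {M | ∀ i j, B i j = 0 → M i j = 0}

/-! ### Dependency graphs and graph-preserving maps -/

/-- `h i` does not depend on coordinate `j`: it factors through the deletion of that
coordinate. -/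
def NotDependsOn {m n : ℕ} (h : Vec n → Vec m) (i : Fin m) (j : Fin n) : Prop :=
  ∃ hbar : ({k : Fin n // k ≠ j} → ℝ) → ℝ, ∀ a : Vec n, h a i = hbar (fun k => a k)

open Classical in
/-- The adjacency matrix of the functional dependency graph of `h`. -/
def depGraph {m n : ℕ} (h : Vec n → Vec m) : Matrix (Fin m) (Fin n) ℝ :=
  fun i j => if NotDependsOn h i j then 0 else 1

/-- `C` is `G`-preserving: `Cᵀ` maps the aligned space of `G` into itself. -/
def MatPreserving {m n : ℕ} (G : Matrix (Fin m) (Fin n) ℝ) (C : Matrix (Fin m) (Fin m) ℝ) :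
    Prop :=
  ∀ M ∈ alignedMat G, C.transpose * M ∈ alignedMat G

/-- A map is `G`-preserving when its dependency graph is. -/
def MapPreserving {m n : ℕ} (G : Matrix (Fin m) (Fin n) ℝ) (c : Vec m → Vec m) : Prop :=
  MatPreserving G (depGraph c)

/-! ### Diffeomorphisms (of class `C¹`) -/

/-- `c` is a `C¹` bijection of `ℝᵐ` with `C¹` inverse. -/
def IsDiffeo {m : ℕ} (c : Vec m → Vec m) : Prop :=
  ContDiff ℝ 1 c ∧ ∃ g : Vec m → Vec m,
    ContDiff ℝ 1 g ∧ Function.LeftInverse g c ∧ Function.RightInverse g c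

/-- `f` is a `C¹` diffeomorphism onto its image; the inverse, defined on the image only, is `C¹`
in the sense that it extends to a `C¹` map on an open set containing the image. -/
def IsDiffeoOntoImage {m n : ℕ} (f : Vec m → Vec n) : Prop :=
  ContDiff ℝ 1 f ∧ ∃ (U : Set (Vec n)) (g : Vec n → Vec m),
    IsOpen U ∧ Set.range f ⊆ U ∧ ContDiffOn ℝ 1 g U ∧ ∀ z, g (f z) = z

/-! ### Latent variable models

Time is indexed from zero: `t : Fin T` stands for the time step `t + 1`, so the past
latents `z¹, …, zᵗ` are a function on `Fin t` and the past auxiliary vectors `a⁰, …, aᵗ` a function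
on `Fin (t + 1)`. -/

/-- A parameter `(f, p, G)`: decoder, transition densities and the two graphs, for auxiliary
variables with values in `A`. `trans t zp ap z` is `p(z | zp, ap)`; for every history with
auxiliary values in `A` it is a probability density in `z`, jointly measurable in the latents. -/
structure Model (dx dz da T : ℕ) (A : Set (Vec da)) where
  decoder : Vec dz → Vec dx
  trans : (t : Fin T) → (Fin t → Vec dz) → (Fin (t + 1) → Vec da) → Vec dz → ℝ
  Gz : Matrix (Fin dz) (Fin dz) ℝ
  Ga : Matrix (Fin dz) (Fin da) ℝ
  binary_Gz : IsBinary Gz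
  binary_Ga : IsBinary Ga
  trans_nonneg : ∀ (t : Fin T) (zp : Fin t → Vec dz) (ap : Fin (t + 1) → Vec da),
    (∀ s, ap s ∈ A) → ∀ z, 0 ≤ trans t zp ap z
  trans_measurable : ∀ (t : Fin T) (ap : Fin (t + 1) → Vec da), (∀ s, ap s ∈ A) →
    Measurable (fun w : (Fin t → Vec dz) × Vec dz => trans t w.1 ap w.2)
  trans_lintegral : ∀ (t : Fin T) (zp : Fin t → Vec dz) (ap : Fin (t + 1) → Vec da),
    (∀ s, ap s ∈ A) → ∫⁻ z, ENNReal.ofReal (trans t zp ap z) = 1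

variable {dx dz da T : ℕ} {A : Set (Vec da)}

/-- The mechanism `p(zᵢ | zp, ap)` at `zᵢ = x`: the `i`-th marginal density of the transition
density, obtained by integrating out the other coordinates. -/
def Model.mech (θ : Model dx dz da T A) (t : Fin T) (i : Fin dz) (zp : Fin t → Vec dz)
    (ap : Fin (t + 1) → Vec da) (x : ℝ) : ℝ :=
  ∫ w : {j : Fin dz // j ≠ i} → ℝ,
    θ.trans t zp ap (fun j => if h : j = i then x else w ⟨j, h⟩)

/-- Observation model: `d_z ≤ d_x` and the decoder is a diffeomorphism onto a closed image. (The
Gaussian noise enters through `Model.obsLaw`.) -/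
def Model.Observation (θ : Model dx dz da T A) : Prop :=
  dz ≤ dx ∧ IsDiffeoOntoImage θ.decoder ∧ IsClosed (Set.range θ.decoder)

/-- Conditionally independent latent factors: the transition density is the product of its
mechanisms, each of which has support `ℝ`. -/
def Model.CondIndep (θ : Model dx dz da T A) : Prop :=
  ∀ (t : Fin T) (zp : Fin t → Vec dz) (ap : Fin (t + 1) → Vec da), (∀ s, ap s ∈ A) →
    (∀ z, θ.trans t zp ap z = ∏ i, θ.mech t i zp ap (z i)) ∧
    ∀ i, (volume.withDensity
      (fun x : ℝ => ENNReal.ofReal (θ.mech t i zp ap x))).support = Set.univ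

/-- The transition model is Markov with respect to the graphs: mechanism `i` depends on the past
only through the coordinates that are parents of `i`. -/
def Model.Markov (θ : Model dx dz da T A) : Prop :=
  ∀ (t : Fin T) (i : Fin dz) (zp zp' : Fin t → Vec dz) (ap ap' : Fin (t + 1) → Vec da),
    (∀ s, ap s ∈ A) → (∀ s, ap' s ∈ A) →
    (∀ s j, θ.Gz i j ≠ 0 → zp s j = zp' s j) →
    (∀ s l, θ.Ga i l ≠ 0 → ap s l = ap' s l) →
    ∀ x, θ.mech t i zp ap x = θ.mech t i zp' ap' x

/-- Smoothness of the transition model (discrete auxiliary variables): for every auxiliary history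
the mechanisms are jointly `C²` in the current coordinate and the past latents. -/
def Model.Smooth (θ : Model dx dz da T A) : Prop :=
  ∀ (t : Fin T) (i : Fin dz) (ap : Fin (t + 1) → Vec da), (∀ s, ap s ∈ A) →
    ContDiff ℝ 2 (fun w : ℝ × (Fin t → Vec dz) => θ.mech t i w.2 ap w.1)

/-! ### The law of the observations -/

/-- The part of a trajectory strictly before time `t`. -/
def before {d : ℕ} (z : Fin T → Vec d) (t : Fin T) : Fin t → Vec d :=
  fun s => z ⟨s, s.2.trans t.2⟩

/-- The part of a trajectory up to and including index `t`. -/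
def upTo {d : ℕ} (a : Fin T → Vec d) (t : Fin T) : Fin (t + 1) → Vec d :=
  fun s => a ⟨s, lt_of_lt_of_le s.2 t.2⟩

/-- The conditional law of the whole latent trajectory given the auxiliary trajectory `a`. -/
def Model.latentLaw (θ : Model dx dz da T A) (a : Fin T → Vec da) :
    Measure (Fin T → Vec dz) :=
  volume.withDensity
    (fun z => ENNReal.ofReal (∏ t, θ.trans t (before z t) (upTo a t) (z t)))

/-- Noise: independent `N(0, v I)` vectors at each time, `v = σ²`; a Dirac mass at `0` if
`v = 0`. -/
def noiseLaw (dx T : ℕ) (v : ℝ≥0) : Measure (Fin T → Vec dx) :=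
  Measure.pi (fun _ => Measure.pi (fun _ => gaussianReal 0 v))

/-- The conditional law of the observations `xᵗ = f(zᵗ) + nᵗ` given `a`, with the noise independent
of the latents. -/
def Model.obsLaw (θ : Model dx dz da T A) (v : ℝ≥0) (a : Fin T → Vec da) :
    Measure (Fin T → Vec dx) :=
  ((θ.latentLaw a).prod (noiseLaw dx T v)).map (fun w t => θ.decoder (w.1 t) + w.2 t)

/-- Observational equivalence, with common noise variance `v`. -/
def ObsEquiv (v : ℝ≥0) (θ θ' : Model dx dz da T A) : Prop :=
  ∀ a : Fin T → Vec da, (∀ t, a t ∈ A) → θ.obsLaw v a = θ'.obsLaw v a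

/-! ### Equivalence relations between models -/

/-- The entanglement map `f⁻¹ ∘ f'` (meaningful when the two decoders have the same image). -/
def entanglement (θ θ' : Model dx dz da T A) : Vec dz → Vec dz :=
  fun z => Function.invFun θ.decoder (θ'.decoder z)

/-- Equivalence up to diffeomorphism. -/
def DiffEquiv (θ θ' : Model dx dz da T A) : Prop :=
  Set.range θ.decoder = Set.range θ'.decoder ∧
  IsDiffeo (entanglement θ θ') ∧
  ∀ (t : Fin T) (ap : Fin (t + 1) → Vec da), (∀ s, ap s ∈ A) →
    ∀ (zp : Fin t → Vec dz) (z : Vec dz),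
      θ'.trans t zp ap z =
        θ.trans t (fun s => entanglement θ θ' (zp s)) ap (entanglement θ θ' z) *
          |(fderiv ℝ (entanglement θ θ') z).det|

/-- `a`-consistency. -/
def AConsistent (θ θ' : Model dx dz da T A) : Prop :=
  ∃ P : Matrix (Fin dz) (Fin dz) ℝ, IsPermMatrix P ∧
    DiffEquiv θ θ' ∧ θ'.Ga = P * θ.Ga ∧
    ∃ c : Vec dz → Vec dz, IsDiffeo c ∧ MapPreserving θ.Ga c ∧
      ∀ z, entanglement θ θ' z = c (P.transpose.mulVec z)

/-! ### Sufficient influence -/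

/-- The vector of partial derivatives of `log p(z | zp, ap)` in `z`. -/
def Model.gradLog (θ : Model dx dz da T A) (t : Fin T) (zp : Fin t → Vec dz)
    (ap : Fin (t + 1) → Vec da) (z : Vec dz) : Vec dz :=
  fun i => fderiv ℝ (fun y => Real.log (θ.trans t zp ap y)) z (Pi.single i 1)

/-- The auxiliary history with `ε` added to coordinate `l` at time `τ`. -/
def bump {k : ℕ} (ap : Fin k → Vec da) (τ : Fin k) (l : Fin da) (ε : ℝ) : Fin k → Vec da :=
  ap + Pi.single τ (Pi.single l ε)

/-- The partial difference of `gradLog` in coordinate `l` of the auxiliary vector at time `τ`. -/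
def Model.partialDiff (θ : Model dx dz da T A) (t : Fin T) (τ : Fin (t + 1)) (l : Fin da)
    (ε : ℝ) (zp : Fin t → Vec dz) (ap : Fin (t + 1) → Vec da) (z : Vec dz) : Vec dz :=
  θ.gradLog t zp (bump ap τ l ε) z - θ.gradLog t zp ap z

/-- The number of children of the auxiliary coordinate `l`. -/
def Model.numChildren (θ : Model dx dz da T A) (l : Fin da) : ℕ :=
  Set.ncard {i | θ.Ga i l ≠ 0}

/-- The data at which a partial difference is taken in coordinate `l`: a time, an earlier time, a
latent and an auxiliary history, and a step, such that both auxiliary histories are admissible.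
The two positivity clauses say that both logarithms are defined at `z`; they
are automatic for densities that vanish nowhere. -/
structure Model.DiffPoint (θ : Model dx dz da T A) (z : Vec dz) (l : Fin da) where
  t : Fin T
  τ : Fin (t + 1)
  zp : Fin t → Vec dz
  ap : Fin (t + 1) → Vec da
  ε : ℝ
  ap_mem : ∀ s, ap s ∈ A
  bump_mem : ap τ + Pi.single l ε ∈ A
  pos : 0 < θ.trans t zp ap z
  pos_bump : 0 < θ.trans t zp (bump ap τ l ε) z

/-- Sufficient influence of a discrete auxiliary variable. -/
def Model.SufficientInfluence (θ : Model dx dz da T A) : Prop :=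
  ∀ᵐ z : Vec dz, ∀ l : Fin da,
    ∃ γ : Fin (θ.numChildren l) → θ.DiffPoint z l,
      Submodule.span ℝ (Set.range fun r =>
        θ.partialDiff (γ r).t (γ r).τ l (γ r).ε (γ r).zp (γ r).ap z) =
      alignedVec (fun i => θ.Ga i l)

end MechSparsity

end

/-!
Observational equivalence determines the models up to a diffeomorphism of the latent space, and the
sparsity of the influence of `a` then constrains the Jacobian of this diffeomorphism.

The characteristic function of the noise has no zero, so the noiseless observations have the same
law under both models (`ObsEquiv.map_decode_eq`). The latent laws charge every open set and the
images of the decoders are closed, so the images coincide and `v = f⁻¹ ∘ f'` is a diffeomorphism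
(`isDiffeo_entanglement`). The change of variables formula identifies the densities of the latent
trajectories, at first almost everywhere and then everywhere by continuity (`density_eq`).
Integrating out the last time steps one after the other and dividing, which is legitimate on a dense
set of trajectories, identifies each transition density: `p'(z | ⋯) = p(v z | v ⋯) |det Dv z|`
(`transition_eq_of_density_eq`, `ObsEquiv.diffEquiv`).

Taking logarithms, then the difference between two auxiliary histories that differ in the single
coordinate `l`, removes the determinant. The gradient of the resulting identity says that `(Dv z)ᵀ`
maps the partial differences of the first model at `v z` to vectors whose `j`-th entry vanishes
unless `l` is a parent of `j` in the second graph (`partialDiff_dotProduct_fderiv_eq_zero`). By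
sufficient influence these partial differences span, so `∂ⱼ vᵢ = 0` whenever `l` is a parent of `i`
in the first graph but not of `j` in the second (`fderiv_entanglement_apply_eq_zero`). As
`det Dv 0 ≠ 0`, there is a permutation `σ` such that no `∂ⱼ v_{σ j}` vanishes at `0`; it embeds the
first graph in the second. If the second graph is not larger, the embedding is an equality, and the
vanishing partial derivatives say precisely that `v`, up to this permutation, preserves the first
graph.
-/

/-! ### Products of transition densities -/

namespace MechSparsity

variable {d T : ℕ}

theorem before_update_of_le (z : Fin T → Vec d) (s t : Fin T) (y : Vec d) (h : t ≤ s) :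
    before (Function.update z s y) t = before z t := by
  funext r
  have : (⟨r, r.2.trans t.2⟩ : Fin T) ≠ s := by
    intro e
    have h1 : (r : ℕ) = s := congrArg Fin.val e
    have h2 : (t : ℕ) ≤ s := h
    have := r.2
    omega
  simp [before, Function.update_of_ne this]

theorem continuous_before (t : Fin T) : Continuous fun z : Fin T → Vec d => before z t :=
  continuous_pi fun _ => continuous_apply _

theorem measurable_density {q : (t : Fin T) → (Fin t → Vec d) → Vec d → ℝ≥0∞}
    (hm : ∀ t : Fin T, Measurable fun w : (Fin t → Vec d) × Vec d => q t w.1 w.2) :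
    Measurable fun z : Fin T → Vec d => ∏ t, q t (before z t) (z t) :=
  Finset.measurable_fun_prod _ fun t _ =>
    (hm t).comp ((continuous_before t).measurable.prodMk (measurable_pi_apply t))

/-- Integrating the last coordinates out of a product of transition densities leaves the product of
the remaining ones. -/
theorem lmarginal_density {q : (t : Fin T) → (Fin t → Vec d) → Vec d → ℝ≥0∞}
    (hm : ∀ t : Fin T, Measurable fun w : (Fin t → Vec d) × Vec d => q t w.1 w.2)
    (h1 : ∀ t zp, ∫⁻ z, q t zp z = 1) {k : ℕ} (hk : k ≤ T) :
    lmarginal (fun _ => volume) (Finset.univ.filter fun t : Fin T => k ≤ t)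
        (fun z => ∏ t, q t (before z t) (z t)) =
      fun z => ∏ t ∈ Finset.univ.filter (fun t : Fin T => (t : ℕ) < k), q t (before z t) (z t) := by
  induction hk using Nat.decreasingInduction with
  | self =>
    have h0 : (Finset.univ.filter fun t : Fin T => T ≤ t) = ∅ := by
      ext t; simp
    have h2 : (Finset.univ.filter fun t : Fin T => (t : ℕ) < T) = Finset.univ := by
      ext t; simp
    rw [h0, h2, lmarginal_empty]
  | of_succ k hk ih =>
    set κ : Fin T := ⟨k, hk⟩
    have h0 : (Finset.univ.filter fun t : Fin T => k ≤ t) =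
        insert κ (Finset.univ.filter fun t : Fin T => k + 1 ≤ t) := by
      ext t
      simp only [Finset.mem_filter, Finset.mem_univ, true_and, Finset.mem_insert, Fin.ext_iff, κ]
      omega
    have h2 : (Finset.univ.filter fun t : Fin T => (t : ℕ) < k + 1) =
        insert κ (Finset.univ.filter fun t : Fin T => (t : ℕ) < k) := by
      ext t
      simp only [Finset.mem_filter, Finset.mem_univ, true_and, Finset.mem_insert, Fin.ext_iff, κ]
      omega
    funext z
    rw [h0, lmarginal_insert _ (measurable_density hm) (by simp [κ]), ih, h2]
    have h3 : ∀ y : Vec d, ∏ t ∈ insert κ (Finset.univ.filter fun t : Fin T => (t : ℕ) < k),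
        q t (before (Function.update z κ y) t) (Function.update z κ y t) =
        q κ (before z κ) y * ∏ t ∈ Finset.univ.filter (fun t : Fin T => (t : ℕ) < k), q t (before z t) (z t) := by
      intro y
      rw [Finset.prod_insert (by simp [κ]), before_update_of_le _ _ _ _ le_rfl,
        Function.update_self]
      congr 1
      refine Finset.prod_congr rfl fun t ht => ?_
      have ht' : (t : ℕ) < k := by simpa using ht
      have hlt : t < κ := ht'
      rw [before_update_of_le _ _ _ _ hlt.le, Function.update_of_ne hlt.ne]
    simp_rw [h3]
    rw [lintegral_mul_const, h1, one_mul]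
    exact (hm κ).comp measurable_prodMk_left

theorem lintegral_density {q : (t : Fin T) → (Fin t → Vec d) → Vec d → ℝ≥0∞}
    (hm : ∀ t : Fin T, Measurable fun w : (Fin t → Vec d) × Vec d => q t w.1 w.2)
    (h1 : ∀ t zp, ∫⁻ z, q t zp z = 1) :
    ∫⁻ z : Fin T → Vec d, ∏ t, q t (before z t) (z t) = 1 := by
  have h := lmarginal_density hm h1 (Nat.zero_le T)
  have h0 : (Finset.univ.filter fun t : Fin T => 0 ≤ (t : ℕ)) = Finset.univ := by simp
  rw [h0, lmarginal_univ] at h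
  rw [volume_pi]
  simpa using congrFun h 0

/-- If each step can be taken in a dense set, whatever the past, then the trajectories all of whose
steps are so taken are dense. -/
theorem dense_trajectories (S : (t : Fin T) → (Fin t → Vec d) → Set (Vec d))
    (hS : ∀ t zp, Dense (S t zp)) :
    Dense {z : Fin T → Vec d | ∀ t, z t ∈ S t (before z t)} := by
  intro z
  rw [Metric.mem_closure_iff]
  intro ε hε
  have key : ∀ k : ℕ, k ≤ T → ∃ y : Fin T → Vec d, (∀ t, dist (z t) (y t) < ε) ∧
      ∀ t : Fin T, (t : ℕ) < k → y t ∈ S t (before y t) := by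
    intro k
    induction k with
    | zero => exact fun _ => ⟨z, by simp [hε], by simp⟩
    | succ k ih =>
      intro hk
      obtain ⟨y, hy, hy'⟩ := ih (by omega)
      set κ : Fin T := ⟨k, hk⟩
      obtain ⟨x, hx, hx'⟩ := Metric.mem_closure_iff.1 (hS κ (before y κ) (z κ)) ε hε
      refine ⟨Function.update y κ x, fun t => ?_, fun t ht => ?_⟩
      · by_cases h : t = κ
        · subst h; simpa using hx'
        · simpa [Function.update_of_ne h] using hy t
      · have hle : t ≤ κ := Nat.lt_succ_iff.1 ht
        rw [before_update_of_le _ _ _ _ hle]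
        rcases hle.eq_or_lt with h | h
        · rw [h]; simpa using hx
        · rw [Function.update_of_ne h.ne]; exact hy' t h
  obtain ⟨y, hy, hy'⟩ := key T le_rfl
  exact ⟨y, fun t => hy' t t.2, (dist_pi_lt_iff hε).2 hy⟩

/-- Continuous transition densities are determined by the density of the trajectory, provided that
one of the two families is positive on dense sets. -/
theorem transition_eq_of_density_eq {p q : (t : Fin T) → (Fin t → Vec d) → Vec d → ℝ}
    (hp0 : ∀ t zp z, 0 ≤ p t zp z) (hq0 : ∀ t zp z, 0 ≤ q t zp z)
    (hp : ∀ t : Fin T, Continuous fun w : (Fin t → Vec d) × Vec d => p t w.1 w.2)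
    (hq : ∀ t : Fin T, Continuous fun w : (Fin t → Vec d) × Vec d => q t w.1 w.2)
    (hp1 : ∀ t zp, ∫⁻ z, ENNReal.ofReal (p t zp z) = 1)
    (hq1 : ∀ t zp, ∫⁻ z, ENNReal.ofReal (q t zp z) = 1)
    (hd : ∀ t zp, Dense {z | 0 < p t zp z})
    (h : ∀ z : Fin T → Vec d, ∏ t, p t (before z t) (z t) = ∏ t, q t (before z t) (z t))
    (t : Fin T) (zp : Fin t → Vec d) (z : Vec d) : p t zp z = q t zp z := by
  have hfull : (fun z : Fin T → Vec d => ∏ t, ENNReal.ofReal (p t (before z t) (z t))) =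
      fun z => ∏ t, ENNReal.ofReal (q t (before z t) (z t)) := by
    funext z
    rw [← ENNReal.ofReal_prod_of_nonneg fun t _ => hp0 t _ _, h,
      ENNReal.ofReal_prod_of_nonneg fun t _ => hq0 t _ _]
  -- The partial products are marginals of the full product.
  have hpart : ∀ k ≤ T, ∀ z : Fin T → Vec d,
      ∏ t ∈ Finset.univ.filter (fun t : Fin T => (t : ℕ) < k), ENNReal.ofReal (p t (before z t) (z t)) =
      ∏ t ∈ Finset.univ.filter (fun t : Fin T => (t : ℕ) < k), ENNReal.ofReal (q t (before z t) (z t)) := by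
    intro k hk z
    have e1 := lmarginal_density (q := fun t zp z => ENNReal.ofReal (p t zp z))
      (fun t => (hp t).measurable.ennreal_ofReal) hp1 hk
    have e2 := lmarginal_density (q := fun t zp z => ENNReal.ofReal (q t zp z))
      (fun t => (hq t).measurable.ennreal_ofReal) hq1 hk
    have := e1.symm.trans ((congrArg _ hfull).trans e2)
    exact congrFun this z
  have hdense := dense_trajectories (fun t zp => {z | 0 < p t zp z}) hd
  have hc := fun (u : Fin T) => (continuous_before (d := d) u).prodMk (continuous_apply u)
  have heq : (fun z : Fin T → Vec d => p t (before z t) (z t)) =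
      fun z => q t (before z t) (z t) := by
    refine Continuous.ext_on hdense ((hp t).comp (hc t)) ((hq t).comp (hc t)) fun z hz => ?_
    have h2 : (Finset.univ.filter fun s : Fin T => (s : ℕ) < t + 1) =
        insert t (Finset.univ.filter fun s : Fin T => (s : ℕ) < t) := by
      ext s
      simp only [Finset.mem_filter, Finset.mem_univ, true_and, Finset.mem_insert, Fin.ext_iff]
      omega
    have e1 := hpart (t + 1) t.2 z
    rw [h2, Finset.prod_insert (by simp), Finset.prod_insert (by simp), ← hpart t t.2.le z] at e1
    have hne : ∏ s ∈ Finset.univ.filter (fun s : Fin T => (s : ℕ) < t), ENNReal.ofReal (p s (before z s) (z s)) ≠ 0 :=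
      Finset.prod_ne_zero_iff.2 fun s _ => by simpa using hz s
    have hnt : ∏ s ∈ Finset.univ.filter (fun s : Fin T => (s : ℕ) < t), ENNReal.ofReal (p s (before z s) (z s)) ≠ ⊤ :=
      ENNReal.prod_ne_top fun s _ => ENNReal.ofReal_ne_top
    have e2 := (ENNReal.mul_left_inj hne hnt).1 e1
    exact (ENNReal.ofReal_eq_ofReal_iff (hp0 _ _ _) (hq0 _ _ _)).1 e2
  -- Every history and current value are part of a trajectory.
  have hext := congrFun heq fun s => if hs : (s : ℕ) < t then zp ⟨s, hs⟩ else z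
  have hb : before (fun s : Fin T => if hs : (s : ℕ) < t then zp ⟨s, hs⟩ else z) t = zp := by
    funext r
    simp [before]
  dsimp only at hext
  rw [hb] at hext
  simpa using hext


/-! ### Removing the noise -/

/-- Convolution with a product of normal laws is cancellative on finite measures, because the
characteristic function of a Gaussian law has no zero. -/
theorem eq_of_map_add_noiseLaw_eq {dx T : ℕ} (v : ℝ≥0) (μ ν : Measure (Fin T → Vec dx))
    [IsFiniteMeasure μ] [IsFiniteMeasure ν]
    (h : μ ∗ noiseLaw dx T v = ν ∗ noiseLaw dx T v) : μ = ν := by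
  have : IsProbabilityMeasure (noiseLaw dx T v) := by unfold noiseLaw; infer_instance
  refine Measure.ext_of_charFunDual (funext fun L => ?_)
  have hL := congrArg (fun ρ => charFunDual ρ L) h
  simp only [charFunDual_conv] at hL
  refine mul_right_cancel₀ ?_ hL
  simp only [noiseLaw, charFunDual_pi, IsGaussian.charFunDual_eq]
  exact Finset.prod_ne_zero_iff.2 fun _ _ => Finset.prod_ne_zero_iff.2 fun _ _ =>
    Complex.exp_ne_zero _

theorem map_add_prod_eq_conv {E F : Type*} [MeasurableSpace E] [AddCommGroup F]
    [MeasurableSpace F] [MeasurableAdd₂ F] (μ : Measure E) [SFinite μ] (ν : Measure F) [SFinite ν]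
    {f : E → F} (hf : Measurable f) :
    (μ.prod ν).map (fun w => f w.1 + w.2) = (μ.map f) ∗ ν := by
  have := Measure.map_prod_map μ ν hf measurable_id
  rw [Measure.map_id] at this
  rw [Measure.conv, this, Measure.map_map (by fun_prop) (by fun_prop)]
  rfl

/-! ### Diffeomorphisms and change of variables -/

theorem IsDiffeo.bijective {v : Vec d → Vec d} (hv : IsDiffeo v) : Function.Bijective v := by
  obtain ⟨-, g, -, hl, hr⟩ := hv
  exact ⟨hl.injective, hr.surjective⟩

theorem IsDiffeo.differentiable {v : Vec d → Vec d} (hv : IsDiffeo v) : Differentiable ℝ v :=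
  hv.1.differentiable one_ne_zero

theorem IsDiffeo.continuous_fderiv {v : Vec d → Vec d} (hv : IsDiffeo v) :
    Continuous (fderiv ℝ v) :=
  hv.1.continuous_fderiv one_ne_zero

theorem IsDiffeo.continuous_abs_det {v : Vec d → Vec d} (hv : IsDiffeo v) :
    Continuous fun z => |(fderiv ℝ v z).det| :=
  (ContinuousLinearMap.continuous_det.comp hv.continuous_fderiv).abs

theorem IsDiffeo.det_fderiv_ne_zero {v : Vec d → Vec d} (hv : IsDiffeo v) (z : Vec d) :
    (fderiv ℝ v z).det ≠ 0 := by
  have hdv := hv.differentiable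
  obtain ⟨-, g, hg, hl, hr⟩ := hv
  have hdg : Differentiable ℝ g := hg.differentiable one_ne_zero
  have h1 : (fderiv ℝ g (v z)).comp (fderiv ℝ v z) = ContinuousLinearMap.id ℝ _ := by
    rw [← fderiv_comp z (hdg _) (hdv _), hl.comp_eq_id, fderiv_id]
  have h2 : LinearMap.det ((fderiv ℝ g (v z) : Vec d →ₗ[ℝ] Vec d) ∘ₗ
      (fderiv ℝ v z : Vec d →ₗ[ℝ] Vec d)) = 1 := by
    rw [← ContinuousLinearMap.toLinearMap_comp, h1]
    simp
  rw [LinearMap.det_comp] at h2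
  exact right_ne_zero_of_mul_eq_one h2

theorem IsDiffeo.lintegral_comp {v : Vec d → Vec d} (hv : IsDiffeo v) (g : Vec d → ℝ≥0∞) :
    ∫⁻ z, ENNReal.ofReal |(fderiv ℝ v z).det| * g (v z) = ∫⁻ z, g z := by
  have h := lintegral_image_eq_lintegral_abs_det_fderiv_mul volume MeasurableSet.univ
    (fun z _ => (hv.differentiable z).hasFDerivAt.hasFDerivWithinAt) hv.bijective.1.injOn g
  rw [Set.image_univ, hv.bijective.2.range_eq] at h
  simpa using h.symm

/-- Change of variables for a diffeomorphism applied at every time step: the Jacobian is the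
product of the Jacobians. -/
theorem IsDiffeo.setLIntegral_trajectory {T : ℕ} {v : Vec d → Vec d} (hv : IsDiffeo v)
    {s : Set (Fin T → Vec d)} (hs : MeasurableSet s) (g : (Fin T → Vec d) → ℝ≥0∞) :
    ∫⁻ z in (fun (z : Fin T → Vec d) t => v (z t)) '' s, g z =
      ∫⁻ z in s, ENNReal.ofReal (∏ t, |(fderiv ℝ v (z t)).det|) * g (fun t => v (z t)) := by
  have hd : ∀ z : Fin T → Vec d, HasFDerivAt (fun (z : Fin T → Vec d) t => v (z t))
      (ContinuousLinearMap.pi fun t =>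
        (fderiv ℝ v (z t)).comp (ContinuousLinearMap.proj t)) z := fun z =>
    hasFDerivAt_pi.2 fun t =>
      ((hv.differentiable (z t)).hasFDerivAt).comp z (ContinuousLinearMap.proj (R := ℝ)
        (φ := fun _ : Fin T => Vec d) t).hasFDerivAt
  rw [lintegral_image_eq_lintegral_abs_det_fderiv_mul volume hs
    (fun z _ => (hd z).hasFDerivWithinAt)
    (fun x _ y _ h => funext fun t => hv.bijective.1 (congrFun h t)) g]
  simp_rw [ContinuousLinearMap.det_pi, Finset.abs_prod]


/-! ### Regularity and positivity of the latent law -/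

variable {dx dz da : ℕ} {A : Set (Vec da)}

theorem upTo_mem {a : Fin T → Vec da} (ha : ∀ t, a t ∈ A) (t : Fin T) (s : Fin (t + 1)) :
    upTo a t s ∈ A :=
  ha _

theorem exists_upTo_eq (t : Fin T) (ap : Fin (t + 1) → Vec da) (hap : ∀ s, ap s ∈ A) :
    ∃ a : Fin T → Vec da, (∀ t, a t ∈ A) ∧ upTo a t = ap := by
  refine ⟨fun s => if h : (s : ℕ) < t + 1 then ap ⟨s, h⟩ else ap 0, fun s => ?_, ?_⟩
  · dsimp only
    split_ifs
    exacts [hap _, hap _]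
  · funext s
    simp only [upTo, dif_pos s.2]

theorem Model.contDiff_trans {θ : Model dx dz da T A} (hind : θ.CondIndep) (hsmooth : θ.Smooth)
    (t : Fin T) {ap : Fin (t + 1) → Vec da} (hap : ∀ s, ap s ∈ A) :
    ContDiff ℝ 2 fun w : (Fin t → Vec dz) × Vec dz => θ.trans t w.1 ap w.2 := by
  have h : (fun w : (Fin t → Vec dz) × Vec dz => θ.trans t w.1 ap w.2) =
      fun w => ∏ i, θ.mech t i w.1 ap (w.2 i) :=
    funext fun w => (hind t w.1 ap hap).1 w.2
  rw [h]
  refine contDiff_prod fun i _ => ?_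
  exact (hsmooth t i ap hap).comp (g := fun w : ℝ × (Fin t → Vec dz) => θ.mech t i w.2 ap w.1)
    (f := fun w : (Fin t → Vec dz) × Vec dz => (w.2 i, w.1)) (by fun_prop)

theorem Model.differentiable_trans {θ : Model dx dz da T A} (hind : θ.CondIndep)
    (hsmooth : θ.Smooth) (t : Fin T) (zp : Fin t → Vec dz) {ap : Fin (t + 1) → Vec da}
    (hap : ∀ s, ap s ∈ A) : Differentiable ℝ (θ.trans t zp ap) :=
  ((Model.contDiff_trans hind hsmooth t hap).comp (contDiff_prodMk_right zp)).differentiable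
    two_ne_zero

/-- Mechanisms with full support are positive on a dense set, hence so is their product. -/
theorem Model.dense_trans_pos {θ : Model dx dz da T A} (hind : θ.CondIndep) (t : Fin T)
    (zp : Fin t → Vec dz) {ap : Fin (t + 1) → Vec da} (hap : ∀ s, ap s ∈ A) :
    Dense {z | 0 < θ.trans t zp ap z} := by
  obtain ⟨hprod, hsupp⟩ := hind t zp ap hap
  have hd : ∀ i, Dense {x | 0 < θ.mech t i zp ap x} := by
    intro i
    refine dense_iff_inter_open.2 fun U hU ⟨x, hx⟩ => ?_
    have hpos := (Measure.mem_support_iff_forall x).1 (hsupp i ▸ Set.mem_univ x) U (hU.mem_nhds hx)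
    by_contra hne
    refine hpos.ne' ?_
    rw [withDensity_apply _ hU.measurableSet]
    refine setLIntegral_eq_zero hU.measurableSet fun y hy => ?_
    exact ENNReal.ofReal_eq_zero.2 (not_lt.1 fun hy' => hne ⟨y, hy, hy'⟩)
  refine (dense_pi Set.univ fun i _ => hd i).mono fun z hz => ?_
  rw [Set.mem_ofPred_eq, hprod]
  exact Finset.prod_pos fun i _ => hz i (Set.mem_univ i)

variable {a : Fin T → Vec da}

theorem Model.isProbabilityMeasure_latentLaw (θ : Model dx dz da T A) (ha : ∀ t, a t ∈ A) :
    IsProbabilityMeasure (θ.latentLaw a) := by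
  constructor
  rw [Model.latentLaw, withDensity_apply _ MeasurableSet.univ, setLIntegral_univ,
    ← lintegral_density (q := fun t zp z => ENNReal.ofReal (θ.trans t zp (upTo a t) z))
      (fun t => (θ.trans_measurable t _ (upTo_mem ha t)).ennreal_ofReal)
      (fun t zp => θ.trans_lintegral t zp _ (upTo_mem ha t))]
  exact lintegral_congr fun z =>
    ENNReal.ofReal_prod_of_nonneg fun t _ => θ.trans_nonneg t _ _ (upTo_mem ha t) _

theorem Model.continuous_density {θ : Model dx dz da T A} (hind : θ.CondIndep)
    (hsmooth : θ.Smooth) (ha : ∀ t, a t ∈ A) :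
    Continuous fun z : Fin T → Vec dz => ∏ t, θ.trans t (before z t) (upTo a t) (z t) :=
  continuous_finsetProd _ fun t _ =>
    (Model.contDiff_trans hind hsmooth t (upTo_mem ha t)).continuous.comp
      ((continuous_before t).prodMk (continuous_apply t))

theorem Model.latentLaw_ne_zero_of_isOpen {θ : Model dx dz da T A} (hind : θ.CondIndep)
    (hsmooth : θ.Smooth) (ha : ∀ t, a t ∈ A) {U : Set (Fin T → Vec dz)} (hU : IsOpen U)
    (hne : U.Nonempty) : θ.latentLaw a U ≠ 0 := by
  have hc := Model.continuous_density hind hsmooth ha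
  rw [Model.latentLaw, Ne, withDensity_apply_eq_zero hc.measurable.ennreal_ofReal]
  have hset : {z : Fin T → Vec dz |
      ENNReal.ofReal (∏ t, θ.trans t (before z t) (upTo a t) (z t)) ≠ 0} =
      {z | 0 < ∏ t, θ.trans t (before z t) (upTo a t) (z t)} := by
    ext z
    simp
  rw [hset]
  refine (((isOpen_lt continuous_const hc).inter hU).measure_pos volume ?_).ne'
  obtain ⟨z, hz, hzU⟩ := (dense_trajectories (fun t zp => {z | 0 < θ.trans t zp (upTo a t) z})
    fun t zp => Model.dense_trans_pos hind t zp (upTo_mem ha t)).inter_open_nonempty U hU hne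
  have hpos : 0 < ∏ t, θ.trans t (before z t) (upTo a t) (z t) :=
    Finset.prod_pos fun t _ => hzU t
  exact ⟨z, hpos, hz⟩

/-! ### Equivalence up to a diffeomorphism -/

theorem Model.Observation.continuous {θ : Model dx dz da T A} (h : θ.Observation) :
    Continuous θ.decoder :=
  h.2.1.1.continuous

theorem Model.Observation.injective {θ : Model dx dz da T A} (h : θ.Observation) :
    Function.Injective θ.decoder := by
  obtain ⟨U, g, -, -, -, hg⟩ := h.2.1.2
  exact Function.LeftInverse.injective hg

theorem continuous_decode {θ : Model dx dz da T A} (h : θ.Observation) :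
    Continuous fun (z : Fin T → Vec dz) t => θ.decoder (z t) :=
  continuous_pi fun t => h.continuous.comp (continuous_apply t)

/-- Observationally equivalent models have equal laws of noiseless observations. -/
theorem ObsEquiv.map_decode_eq {v : ℝ≥0} {θ θ' : Model dx dz da T A} (h : ObsEquiv v θ θ')
    (hobs : θ.Observation) (hobs' : θ'.Observation) (ha : ∀ t, a t ∈ A) :
    (θ.latentLaw a).map (fun z t => θ.decoder (z t)) =
      (θ'.latentLaw a).map (fun z t => θ'.decoder (z t)) := by
  have := θ.isProbabilityMeasure_latentLaw ha
  have := θ'.isProbabilityMeasure_latentLaw ha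
  have : IsProbabilityMeasure (noiseLaw dx T v) := by unfold noiseLaw; infer_instance
  refine eq_of_map_add_noiseLaw_eq v _ _ ?_
  rw [← map_add_prod_eq_conv _ _ (continuous_decode hobs).measurable,
    ← map_add_prod_eq_conv _ _ (continuous_decode hobs').measurable]
  exact h a ha

/-- The image of a decoder is recovered from the law of the noiseless observations, because it is
closed and the latent law charges every open set. -/
theorem range_decoder_subset {v : ℝ≥0} {θ θ' : Model dx dz da T A} (hT : 0 < T)
    (hA : A.Nonempty) (h : ObsEquiv v θ θ') (hobs : θ.Observation) (hobs' : θ'.Observation)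
    (hind' : θ'.CondIndep) (hsmooth' : θ'.Smooth) :
    Set.range θ'.decoder ⊆ Set.range θ.decoder := by
  obtain ⟨a₀, ha₀⟩ := hA
  have hmap := h.map_decode_eq hobs hobs' (a := fun _ => a₀) fun _ => ha₀
  set t₀ : Fin T := ⟨0, hT⟩
  have hV : IsOpen {x : Fin T → Vec dx | x t₀ ∈ (Set.range θ.decoder)ᶜ} :=
    hobs.2.2.isOpen_compl.preimage (continuous_apply t₀)
  have h0 := congrArg (fun μ => μ {x : Fin T → Vec dx | x t₀ ∈ (Set.range θ.decoder)ᶜ}) hmap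
  rw [Measure.map_apply (continuous_decode hobs).measurable hV.measurableSet,
    Measure.map_apply (continuous_decode hobs').measurable hV.measurableSet] at h0
  have hempty : (fun (z : Fin T → Vec dz) t => θ.decoder (z t)) ⁻¹'
      {x : Fin T → Vec dx | x t₀ ∈ (Set.range θ.decoder)ᶜ} = ∅ := by
    ext z; simp
  rw [hempty, measure_empty] at h0
  rintro _ ⟨z, rfl⟩
  by_contra hz
  exact Model.latentLaw_ne_zero_of_isOpen hind' hsmooth' (fun _ => ha₀)
    (hV.preimage (continuous_decode hobs')) ⟨fun _ => z, hz⟩ h0.symm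

theorem decoder_entanglement {θ θ' : Model dx dz da T A}
    (hr : Set.range θ'.decoder ⊆ Set.range θ.decoder) (z : Vec dz) :
    θ.decoder (entanglement θ θ' z) = θ'.decoder z :=
  Function.invFun_eq (hr ⟨z, rfl⟩)

theorem contDiff_entanglement {θ θ' : Model dx dz da T A}
    (hr : Set.range θ'.decoder ⊆ Set.range θ.decoder) (hobs : θ.Observation)
    (hobs' : θ'.Observation) : ContDiff ℝ 1 (entanglement θ θ') := by
  obtain ⟨U, g, hU, hU', hg, hgf⟩ := hobs.2.1.2
  have h : entanglement θ θ' = g ∘ θ'.decoder := by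
    funext z
    rw [Function.comp_apply, ← decoder_entanglement hr, hgf]
  rw [h, ← contDiffOn_univ]
  exact hg.comp hobs'.2.1.1.contDiffOn fun z _ => hU' (hr ⟨z, rfl⟩)

theorem isDiffeo_entanglement {θ θ' : Model dx dz da T A}
    (hr : Set.range θ.decoder = Set.range θ'.decoder) (hobs : θ.Observation)
    (hobs' : θ'.Observation) : IsDiffeo (entanglement θ θ') := by
  refine ⟨contDiff_entanglement hr.superset hobs hobs', entanglement θ' θ,
    contDiff_entanglement hr.subset hobs' hobs, fun z => ?_, fun z => ?_⟩
  · apply hobs'.injective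
    rw [decoder_entanglement hr.subset, decoder_entanglement hr.superset]
  · apply hobs.injective
    rw [decoder_entanglement hr.superset, decoder_entanglement hr.subset]

/-- The density of the trajectories transforms under the entanglement map with its Jacobian. -/
theorem density_eq {v : ℝ≥0} {θ θ' : Model dx dz da T A} (h : ObsEquiv v θ θ')
    (hr : Set.range θ.decoder = Set.range θ'.decoder) (hobs : θ.Observation)
    (hobs' : θ'.Observation) (hind : θ.CondIndep) (hind' : θ'.CondIndep) (hsmooth : θ.Smooth)
    (hsmooth' : θ'.Smooth) (ha : ∀ t, a t ∈ A) (z : Fin T → Vec dz) :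
    ∏ t, θ'.trans t (before z t) (upTo a t) (z t) =
      ∏ t, (θ.trans t (fun s => entanglement θ θ' (before z t s)) (upTo a t)
        (entanglement θ θ' (z t)) * |(fderiv ℝ (entanglement θ θ') (z t)).det|) := by
  have hv := isDiffeo_entanglement hr hobs hobs'
  set w := entanglement θ θ' with hw
  set W : (Fin T → Vec dz) → Fin T → Vec dz := fun z t => w (z t) with hW
  have hWc : Continuous W := continuous_pi fun t => hv.1.continuous.comp (continuous_apply t)
  have hWinj : Function.Injective W :=
    fun x y e => funext fun t => hv.bijective.1 (congrFun e t)
  have hc : Continuous fun z : Fin T → Vec dz =>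
      (∏ t, |(fderiv ℝ w (z t)).det|) * ∏ t, θ.trans t (before (W z) t) (upTo a t) (W z t) :=
    (continuous_finsetProd _ fun t _ => hv.continuous_abs_det.comp (continuous_apply t)).mul
      ((Model.continuous_density hind hsmooth ha).comp hWc)
  have hc' := Model.continuous_density hind' hsmooth' ha
  have hF : Function.Injective fun (z : Fin T → Vec dz) t => θ.decoder (z t) :=
    fun x y e => funext fun t => hobs.injective (congrFun e t)
  have hF' : Function.Injective fun (z : Fin T → Vec dz) t => θ'.decoder (z t) :=
    fun x y e => funext fun t => hobs'.injective (congrFun e t)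
  have hae : (fun z : Fin T → Vec dz =>
        ENNReal.ofReal (∏ t, θ'.trans t (before z t) (upTo a t) (z t))) =ᵐ[volume]
      fun z => ENNReal.ofReal ((∏ t, |(fderiv ℝ w (z t)).det|) *
        ∏ t, θ.trans t (before (W z) t) (upTo a t) (W z t)) := by
    rw [← withDensity_eq_iff_of_sigmaFinite hc'.measurable.ennreal_ofReal.aemeasurable
      hc.measurable.ennreal_ofReal.aemeasurable]
    refine Measure.ext fun s hs => ?_
    -- Both latent laws are compared on the image of `s` in the space of noiseless observations.
    have himg : (fun (z : Fin T → Vec dz) t => θ'.decoder (z t)) '' s =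
        (fun (z : Fin T → Vec dz) t => θ.decoder (z t)) '' (W '' s) := by
      rw [Set.image_image]
      refine Set.image_congr fun z _ => funext fun t => ?_
      exact (decoder_entanglement hr.superset (z t)).symm
    have hms : MeasurableSet ((fun (z : Fin T → Vec dz) t => θ'.decoder (z t)) '' s) :=
      ((continuous_decode hobs').measurableEmbedding hF').measurableSet_image.2 hs
    have hWs : MeasurableSet (W '' s) := (hWc.measurableEmbedding hWinj).measurableSet_image.2 hs
    have hl := congrArg (fun μ => μ ((fun (z : Fin T → Vec dz) t => θ'.decoder (z t)) '' s))
      (h.map_decode_eq hobs hobs' ha)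
    rw [Measure.map_apply (continuous_decode hobs).measurable hms,
      Measure.map_apply (continuous_decode hobs').measurable hms,
      Set.preimage_image_eq _ hF', himg, Set.preimage_image_eq _ hF, Model.latentLaw,
      Model.latentLaw, withDensity_apply _ hWs, hv.setLIntegral_trajectory hs] at hl
    rw [← hl, withDensity_apply _ hs]
    refine lintegral_congr fun z => ?_
    rw [ENNReal.ofReal_mul (Finset.prod_nonneg fun t _ => abs_nonneg _)]
  have hae' : (fun z : Fin T → Vec dz =>
        ∏ t, θ'.trans t (before z t) (upTo a t) (z t)) =ᵐ[volume]
      fun z => (∏ t, |(fderiv ℝ w (z t)).det|) *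
        ∏ t, θ.trans t (before (W z) t) (upTo a t) (W z t) := by
    filter_upwards [hae] with z hz
    refine (ENNReal.ofReal_eq_ofReal_iff ?_ ?_).1 hz
    · exact Finset.prod_nonneg fun t _ => θ'.trans_nonneg t _ _ (upTo_mem ha t) _
    · exact mul_nonneg (Finset.prod_nonneg fun t _ => abs_nonneg _)
        (Finset.prod_nonneg fun t _ => θ.trans_nonneg t _ _ (upTo_mem ha t) _)
  have := congrFun ((hc'.ae_eq_iff_eq volume hc).1 hae') z
  rw [this, Finset.prod_mul_distrib, mul_comm]
  rfl

/-- Observationally equivalent models agree up to a diffeomorphism of the latent space. -/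
theorem ObsEquiv.diffEquiv {v : ℝ≥0} {θ θ' : Model dx dz da T A} (hT : 0 < T)
    (hA : A.Nonempty) (h : ObsEquiv v θ θ') (hobs : θ.Observation) (hobs' : θ'.Observation)
    (hind : θ.CondIndep) (hind' : θ'.CondIndep) (hsmooth : θ.Smooth) (hsmooth' : θ'.Smooth) :
    DiffEquiv θ θ' := by
  have hr : Set.range θ.decoder = Set.range θ'.decoder :=
    (range_decoder_subset hT hA (fun a ha => (h a ha).symm) hobs' hobs hind hsmooth).antisymm
      (range_decoder_subset hT hA h hobs hobs' hind' hsmooth')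
  have hv := isDiffeo_entanglement hr hobs hobs'
  refine ⟨hr, hv, fun t ap hap zp z => ?_⟩
  obtain ⟨a, ha, rfl⟩ := exists_upTo_eq t ap hap
  refine transition_eq_of_density_eq
    (p := fun t zp z => θ'.trans t zp (upTo a t) z)
    (q := fun t zp z => θ.trans t (fun s => entanglement θ θ' (zp s)) (upTo a t)
        (entanglement θ θ' z) * |(fderiv ℝ (entanglement θ θ') z).det|)
    (fun t zp z => θ'.trans_nonneg t _ _ (upTo_mem ha t) _)
    (fun t zp z => mul_nonneg (θ.trans_nonneg t _ _ (upTo_mem ha t) _) (abs_nonneg _))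
    (fun t => (Model.contDiff_trans hind' hsmooth' t (upTo_mem ha t)).continuous)
    (fun t => ?_)
    (fun t zp => θ'.trans_lintegral t zp _ (upTo_mem ha t))
    (fun t zp => ?_)
    (fun t zp => Model.dense_trans_pos hind' t zp (upTo_mem ha t))
    (density_eq h hr hobs hobs' hind hind' hsmooth hsmooth' ha) t zp z
  · refine Continuous.mul ?_ (hv.continuous_abs_det.comp continuous_snd)
    exact (Model.contDiff_trans hind hsmooth t (upTo_mem ha t)).continuous.comp
      ((continuous_pi fun s => hv.1.continuous.comp
        ((continuous_apply s).comp continuous_fst)).prodMk (hv.1.continuous.comp continuous_snd))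
  · rw [← θ.trans_lintegral t (fun s => entanglement θ θ' (zp s)) _ (upTo_mem ha t),
      ← hv.lintegral_comp fun z => ENNReal.ofReal
        (θ.trans t (fun s => entanglement θ θ' (zp s)) (upTo a t) z)]
    refine lintegral_congr fun z => ?_
    rw [mul_comm, ENNReal.ofReal_mul (abs_nonneg _)]


/-! ### Zeros of the Jacobian of the entanglement map -/

theorem bump_mem {k : ℕ} {ap : Fin k → Vec da} (hap : ∀ s, ap s ∈ A) {τ : Fin k} {l : Fin da}
    {ε : ℝ} (h : ap τ + Pi.single l ε ∈ A) (s : Fin k) : bump ap τ l ε s ∈ A := by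
  rcases eq_or_ne s τ with rfl | hs
  · simpa [bump] using h
  · simpa [bump, hs] using hap s

theorem bump_apply_of_ne {k : ℕ} (ap : Fin k → Vec da) (τ : Fin k) {l m : Fin da} (h : m ≠ l)
    (ε : ℝ) (s : Fin k) : bump ap τ l ε s m = ap s m := by
  rcases eq_or_ne s τ with rfl | hs
  · simp [bump, h]
  · simp [bump, hs]

/-- If the auxiliary coordinate `l` does not influence the latent coordinate `j` of the second
model, then the `j`-th column of the Jacobian of the entanglement map is orthogonal to the partial
differences of the first model in coordinate `l`: along the `j`-th axis the ratio of the
two densities of the second model is constant, and the Jacobian determinant cancels from it. -/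
theorem partialDiff_dotProduct_fderiv_eq_zero {θ θ' : Model dx dz da T A} {w : Vec dz → Vec dz}
    (hv : IsDiffeo w)
    (htrans : ∀ (t : Fin T) (ap : Fin (t + 1) → Vec da), (∀ s, ap s ∈ A) →
      ∀ (zp : Fin t → Vec dz) (z : Vec dz), θ'.trans t zp ap z =
        θ.trans t (fun s => w (zp s)) ap (w z) * |(fderiv ℝ w z).det|)
    (hind : θ.CondIndep) (hind' : θ'.CondIndep) (hmarkov' : θ'.Markov) (hsmooth : θ.Smooth)
    {j : Fin dz} {l : Fin da} (hj : θ'.Ga j l = 0) (z : Vec dz) (γ : θ.DiffPoint (w z) l) :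
    θ.partialDiff γ.t γ.τ l γ.ε γ.zp γ.ap (w z) ⬝ᵥ fderiv ℝ w z (Pi.single j 1) = 0 := by
  obtain ⟨g, -, -, hr⟩ := hv.2
  have hb := bump_mem γ.ap_mem γ.bump_mem
  have hd1 := Model.differentiable_trans hind hsmooth γ.t γ.zp hb
  have hd0 := Model.differentiable_trans hind hsmooth γ.t γ.zp γ.ap_mem
  have hlog1 := (hd1 (w z)).log γ.pos_bump.ne'
  have hlog0 := (hd0 (w z)).log γ.pos.ne'
  set zp' : Fin γ.t → Vec dz := fun s => g (γ.zp s)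
  -- Along the `j`-th axis only the `j`-th factor of the second model varies.
  have hfac : ∀ ap : Fin (γ.t + 1) → Vec da, (∀ s, ap s ∈ A) → ∀ x : ℝ,
      θ.trans γ.t γ.zp ap (w (Function.update z j x)) *
          |(fderiv ℝ w (Function.update z j x)).det| =
        θ'.mech γ.t j zp' ap x * ∏ i ∈ Finset.univ.erase j, θ'.mech γ.t i zp' ap (z i) := by
    intro ap hap x
    have e := htrans γ.t ap hap zp' (Function.update z j x)
    have e' : (fun s => w (zp' s)) = γ.zp := funext fun s => hr _
    rw [e'] at e
    rw [← e, (hind' γ.t zp' ap hap).1, ← Finset.mul_prod_erase _ _ (Finset.mem_univ j),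
      Function.update_self]
    congr 1
    refine Finset.prod_congr rfl fun i hi => ?_
    rw [Function.update_of_ne (Finset.ne_of_mem_erase hi)]
  -- By the Markov property, that factor is the same for both auxiliary histories.
  have hmech : ∀ x, θ'.mech γ.t j zp' (bump γ.ap γ.τ l γ.ε) x = θ'.mech γ.t j zp' γ.ap x := by
    refine hmarkov' γ.t j zp' zp' _ _ hb γ.ap_mem (fun _ _ _ => rfl) fun s m hm => ?_
    refine bump_apply_of_ne _ _ (fun e => hm ?_) _ _
    rw [e, hj]
  set K0 := ∏ i ∈ Finset.univ.erase j, θ'.mech γ.t i zp' γ.ap (z i)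
  set K1 := ∏ i ∈ Finset.univ.erase j, θ'.mech γ.t i zp' (bump γ.ap γ.τ l γ.ε) (z i)
  have hdet : ∀ y, |(fderiv ℝ w y).det| ≠ 0 := fun y => abs_ne_zero.2 (hv.det_fderiv_ne_zero y)
  have hK0 : K0 ≠ 0 := by
    intro h0
    have e : _ = θ'.mech γ.t j zp' γ.ap (z j) * K0 := hfac _ γ.ap_mem (z j)
    rw [Function.update_eq_self, h0, mul_zero] at e
    exact mul_ne_zero γ.pos.ne' (hdet z) e
  have hK1 : K1 ≠ 0 := by
    intro h0
    have e : _ = θ'.mech γ.t j zp' (bump γ.ap γ.τ l γ.ε) (z j) * K1 := hfac _ hb (z j)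
    rw [Function.update_eq_self, h0, mul_zero] at e
    exact mul_ne_zero γ.pos_bump.ne' (hdet z) e
  have hcross : ∀ x, θ.trans γ.t γ.zp (bump γ.ap γ.τ l γ.ε) (w (Function.update z j x)) * K0 =
      θ.trans γ.t γ.zp γ.ap (w (Function.update z j x)) * K1 := by
    intro x
    have e0 := hfac _ γ.ap_mem x
    have e1 := hfac _ hb x
    rw [hmech] at e1
    refine mul_right_cancel₀ (hdet (Function.update z j x)) ?_
    -- The two factorizations have the same determinant and the same `j`-th factor.
    linear_combination K0 * e1 - K1 * e0
  have hupd : Continuous fun x : ℝ => w (Function.update z j x) :=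
    hv.1.continuous.comp (continuous_const.update j continuous_id)
  have hpos : ∀ᶠ x in nhds (z j), θ.trans γ.t γ.zp γ.ap (w (Function.update z j x)) ≠ 0 := by
    refine (hd0.continuous.comp hupd).continuousAt.eventually_ne ?_
    simpa using γ.pos.ne'
  have hpos' : ∀ᶠ x in nhds (z j),
      θ.trans γ.t γ.zp (bump γ.ap γ.τ l γ.ε) (w (Function.update z j x)) ≠ 0 := by
    refine (hd1.continuous.comp hupd).continuousAt.eventually_ne ?_
    simpa using γ.pos_bump.ne'
  have hconst : (fun x => Real.log (θ.trans γ.t γ.zp (bump γ.ap γ.τ l γ.ε)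
        (w (Function.update z j x))) -
      Real.log (θ.trans γ.t γ.zp γ.ap (w (Function.update z j x)))) =ᶠ[nhds (z j)]
      fun _ => Real.log K1 - Real.log K0 := by
    filter_upwards [hpos, hpos'] with x h0 h1
    have e := congrArg Real.log (hcross x)
    rw [Real.log_mul h1 hK0, Real.log_mul h0 hK1] at e
    linarith
  have hcurve : HasDerivAt (fun x => w (Function.update z j x))
      (fderiv ℝ w z (Pi.single j 1)) (z j) := by
    have h1 := hasDerivAt_update z j (z j)
    have h2 : HasFDerivAt w (fderiv ℝ w z) (Function.update z j (z j)) := by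
      rw [Function.update_eq_self]
      exact (hv.differentiable z).hasFDerivAt
    exact h2.comp_hasDerivAt (z j) h1
  have hz : w (Function.update z j (z j)) = w z := by rw [Function.update_eq_self]
  have hder := (HasFDerivAt.comp_hasDerivAt (f := fun x => w (Function.update z j x)) (z j)
    (l := fun y => Real.log (θ.trans γ.t γ.zp (bump γ.ap γ.τ l γ.ε) y) -
      Real.log (θ.trans γ.t γ.zp γ.ap y))
    (by rw [hz]; exact hlog1.hasFDerivAt.sub hlog0.hasFDerivAt) hcurve)
  have h0 := hder.unique ((hasDerivAt_const (z j) (Real.log K1 - Real.log K0)).congr_of_eventuallyEq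
    hconst)
  rw [← h0]
  set φ := fderiv ℝ (fun y => Real.log (θ.trans γ.t γ.zp (bump γ.ap γ.τ l γ.ε) y)) (w z) -
    fderiv ℝ (fun y => Real.log (θ.trans γ.t γ.zp γ.ap y)) (w z)
  have hsum := (φ : Vec dz →ₗ[ℝ] ℝ).pi_apply_eq_sum_univ (fderiv ℝ w z (Pi.single j 1))
  refine Eq.trans ?_ hsum.symm
  refine Finset.sum_congr rfl fun i _ => ?_
  rw [smul_eq_mul, mul_comm]
  congr 1
  have : (fun k => if i = k then (1 : ℝ) else 0) = Pi.single i 1 := by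
    funext k
    simp [Pi.single_apply, eq_comm]
  rw [this]
  rfl

/-- Where the first model is sufficiently influenced by `a`, the orthogonality relations force
entries of the Jacobian of the entanglement map to vanish; by continuity they vanish everywhere. -/
theorem fderiv_entanglement_apply_eq_zero {θ θ' : Model dx dz da T A} (h : DiffEquiv θ θ')
    (hind : θ.CondIndep) (hind' : θ'.CondIndep) (hmarkov' : θ'.Markov) (hsmooth : θ.Smooth)
    (hinfl : θ.SufficientInfluence) {i j : Fin dz} {l : Fin da} (hi : θ.Ga i l ≠ 0)
    (hj : θ'.Ga j l = 0) (z : Vec dz) :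
    fderiv ℝ (entanglement θ θ') z (Pi.single j 1) i = 0 := by
  have hv := h.2.1
  obtain ⟨g, hg, hl, hr⟩ := hv.2
  have hdense := (Measure.dense_of_ae hinfl).preimage
    (IsOpenMap.of_inverse hg.continuous hr hl)
  have hcont : Continuous fun z => fderiv ℝ (entanglement θ θ') z (Pi.single j 1) i :=
    (continuous_apply i).comp (hv.continuous_fderiv.clm_apply continuous_const)
  refine congrFun (hcont.ext_on hdense continuous_const (g := fun _ => 0) fun z hz => ?_) z
  obtain ⟨γ, hγ⟩ := hz l
  have hmem : (Pi.single i 1 : Vec dz) ∈ alignedVec (fun i => θ.Ga i l) := by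
    intro k hk
    refine Pi.single_eq_of_ne ?_ _
    rintro rfl
    exact hi hk
  rw [← hγ] at hmem
  have hspan : ∀ x ∈ Submodule.span ℝ (Set.range fun r =>
      θ.partialDiff (γ r).t (γ r).τ l (γ r).ε (γ r).zp (γ r).ap (entanglement θ θ' z)),
      x ⬝ᵥ fderiv ℝ (entanglement θ θ') z (Pi.single j 1) = 0 := by
    intro x hx
    induction hx using Submodule.span_induction with
    | mem x hx =>
      obtain ⟨r, rfl⟩ := hx
      exact partialDiff_dotProduct_fderiv_eq_zero hv h.2.2 hind hind' hmarkov' hsmooth hj z (γ r)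
    | zero => exact zero_dotProduct _
    | add x y _ _ hx hy => rw [add_dotProduct, hx, hy, add_zero]
    | smul c x _ hx => rw [smul_dotProduct, hx, smul_zero]
  simpa using hspan _ hmem

/-! ### Permutations and graphs -/

/-- An invertible linear map has nonzero entries along some permutation, as its determinant has a
nonzero term. -/
theorem exists_perm_apply_ne_zero {d : ℕ} (L : Vec d →L[ℝ] Vec d) (hL : L.det ≠ 0) :
    ∃ σ : Equiv.Perm (Fin d), ∀ j, L (Pi.single j 1) (σ j) ≠ 0 := by
  have h : (LinearMap.toMatrix' (L : Vec d →ₗ[ℝ] Vec d)).det ≠ 0 := by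
    rwa [LinearMap.det_toMatrix']
  rw [Matrix.det_apply] at h
  obtain ⟨σ, -, hσ⟩ := Finset.exists_ne_zero_of_sum_ne_zero h
  refine ⟨σ, fun j hj => hσ ?_⟩
  rw [Finset.prod_eq_zero (Finset.mem_univ j), smul_zero]
  rw [LinearMap.toMatrix'_apply]
  exact hj

theorem permMatrix_mul_apply {m n : ℕ} (σ : Equiv.Perm (Fin m)) (G : Matrix (Fin m) (Fin n) ℝ)
    (j : Fin m) (l : Fin n) : (σ.permMatrix ℝ * G) j l = G (σ j) l := by
  rw [Equiv.Perm.permMatrix, PEquiv.toMatrix_toPEquiv_mul]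
  rfl

theorem l0_permMatrix_mul {m n : ℕ} (σ : Equiv.Perm (Fin m)) (G : Matrix (Fin m) (Fin n) ℝ) :
    l0 (σ.permMatrix ℝ * G) = l0 G := by
  refine Set.ncard_congr (fun q _ => (σ q.1, q.2)) (fun q hq => ?_) (fun q r _ _ hqr => ?_)
    fun q hq => ⟨(σ.symm q.1, q.2), ?_, by simp⟩
  · simpa [permMatrix_mul_apply] using hq
  · simpa [Prod.ext_iff] using hqr
  · simpa [permMatrix_mul_apply] using hq

theorem eq_of_suppSubset_of_l0_le {m n : ℕ} {M N : Matrix (Fin m) (Fin n) ℝ} (hM : IsBinary M)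
    (hN : IsBinary N) (hMN : SuppSubset M N) (hle : l0 N ≤ l0 M) : M = N := by
  have hs : {q : Fin m × Fin n | M q.1 q.2 ≠ 0} = {q | N q.1 q.2 ≠ 0} :=
    Set.eq_of_subset_of_ncard_le (fun q hq => hMN _ _ hq) hle
  ext i j
  have hij : M i j ≠ 0 ↔ N i j ≠ 0 := Set.ext_iff.1 hs (i, j)
  rcases hM i j with h1 | h1 <;> rcases hN i j with h2 | h2 <;> simp_all

theorem apply_update_eq_of_fderiv_eq_zero {d : ℕ} {v : Vec d → Vec d} (hv : Differentiable ℝ v)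
    {i j : Fin d} (h : ∀ z, fderiv ℝ v z (Pi.single j 1) i = 0) (z : Vec d) (x y : ℝ) :
    v (Function.update z j x) i = v (Function.update z j y) i := by
  have hder : ∀ x, HasDerivAt (fun x => v (Function.update z j x) i) 0 x := by
    intro x
    have h1 := (hv (Function.update z j x)).hasFDerivAt.comp_hasDerivAt x
      (hasDerivAt_update z j x)
    rw [← h (Function.update z j x)]
    exact hasDerivAt_pi.1 h1 i
  exact is_const_of_deriv_eq_zero (fun x => (hder x).differentiableAt) (fun x => (hder x).deriv)
    x y

end MechSparsity

open MechSparsity in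
theorem mainTheorem2 {dx dz da T : ℕ} (hT : 0 < T)
    (A : Set (MechSparsity.Vec da)) (hA : A.Nonempty) (v : NNReal)
    (θ θ' : MechSparsity.Model dx dz da T A)
    (hobs : θ.Observation) (hobs' : θ'.Observation)
    (hind : θ.CondIndep) (hind' : θ'.CondIndep)
    (hmarkov : θ.Markov) (hmarkov' : θ'.Markov)
    (hsmooth : θ.Smooth) (hsmooth' : θ'.Smooth)
    (hequiv : MechSparsity.ObsEquiv v θ θ')
    (hinfl : θ.SufficientInfluence) :
    (∃ P : Matrix (Fin dz) (Fin dz) ℝ,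
        MechSparsity.IsPermMatrix P ∧ MechSparsity.SuppSubset (P * θ.Ga) θ'.Ga) ∧
      (MechSparsity.l0 θ'.Ga ≤ MechSparsity.l0 θ.Ga → MechSparsity.AConsistent θ θ') := by
  have hde := hequiv.diffEquiv hT hA hobs hobs' hind hind' hsmooth hsmooth'
  have hv := hde.2.1
  obtain ⟨σ, hσ⟩ := exists_perm_apply_ne_zero _ (hv.det_fderiv_ne_zero 0)
  have hsub : SuppSubset (σ.permMatrix ℝ * θ.Ga) θ'.Ga := by
    intro j l hjl hj
    rw [permMatrix_mul_apply] at hjl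
    exact hσ j (fderiv_entanglement_apply_eq_zero hde hind hind' hmarkov' hsmooth hinfl hjl hj 0)
  refine ⟨⟨σ.permMatrix ℝ, ⟨σ, rfl⟩, hsub⟩, fun hle => ?_⟩
  have hGa : σ.permMatrix ℝ * θ.Ga = θ'.Ga := by
    refine eq_of_suppSubset_of_l0_le (fun i j => ?_) θ'.binary_Ga hsub
      (by rwa [l0_permMatrix_mul])
    rw [permMatrix_mul_apply]
    exact θ.binary_Ga _ _
  obtain ⟨g, hg, hl, hr⟩ := hv.2
  refine ⟨σ.permMatrix ℝ, ⟨σ, rfl⟩, hde, hGa.symm, fun y => entanglement θ θ' (y ∘ σ),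
    ⟨hv.1.comp (contDiff_pi.2 fun j => contDiff_apply ℝ ℝ (σ j)), fun z => g z ∘ σ.symm,
      contDiff_pi.2 fun j => (contDiff_apply ℝ ℝ (σ.symm j)).comp hg, fun y => ?_, fun z => ?_⟩,
    fun M hM j l hjl => ?_, fun z => ?_⟩
  · funext k
    simp [hl (y ∘ σ)]
  · have : (g z ∘ σ.symm) ∘ σ = g z := by funext k; simp
    simp only [this, hr z]
  · rw [Matrix.mul_apply]
    refine Finset.sum_eq_zero fun i _ => ?_
    by_cases hi : θ.Ga i l = 0
    · rw [hM i l hi, mul_zero]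
    · have hj' : θ'.Ga (σ.symm j) l = 0 := by
        rw [← hGa, permMatrix_mul_apply, Equiv.apply_symm_apply, hjl]
      have hnd : NotDependsOn (fun y => entanglement θ θ' (y ∘ σ)) i j := by
        refine ⟨fun w => entanglement θ θ' ((fun k => if h : k ≠ j then w ⟨k, h⟩ else 0) ∘ σ) i,
          fun a => ?_⟩
        have e := apply_update_eq_of_fderiv_eq_zero hv.differentiable
          (fun z => fderiv_entanglement_apply_eq_zero hde hind hind' hmarkov' hsmooth hinfl hi
            hj' z) (a ∘ σ) ((a ∘ σ) (σ.symm j)) 0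
        rw [Function.update_eq_self, ← Function.update_comp_equiv] at e
        refine e.trans ?_
        congr 3
        funext k
        by_cases hk : k = j
        · subst hk; simp
        · simp [hk]
      rw [Matrix.transpose_apply, depGraph, if_pos hnd, zero_mul]
  · congr 1
    funext k
    rw [Function.comp_apply, Matrix.transpose_permMatrix, Matrix.permMatrix_mulVec]
    simp
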